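/- Let $E$ and $F$ be real Banach lattices with norm duals $E'$ and $F'$ (which are Banach lattices under the order $f\le g \iff f(x)\le g(x)$ for all $x\ge 0$). A sequence $(f_n)$ in the dual is called disjoint if $|f_m|\wedge|f_n|=0$ for all $m\neq n$. A norm bounded subset $B$ of a Banach lattice $G$ is almost limited if $\sup_{x\in B}|f_n(x)|\to 0$ for every disjoint weak* null sequence $(f_n)\subset G'$. The set $B$ is solid if $|y|\le|x|$ and $x\in B$ imply $y\in B$. The lattice $G$ has property (d) if $|f_n|\to 0$ in the weak* topology for every disjoint weak* null sequence $(f_n)\subset G'$. Theorem 2.3. Let $T\colon E\to F$ be an order bounded linear operator (that is, $T$ maps order bounded sets to order bounded sets), and let $A\subset E$ be a solid almost limited set. If $F$ has property (d), then $T(A)$ is an almost limited subset of $F$. -/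

import Mathlib

open Filter Topology

/-!
# Banach lattices, the dual Banach lattice, almost limited sets

A (real) Banach lattice is a type `E` with
`[NormedAddCommGroup E] [NormedSpace ℝ E] [CompleteSpace E] [Lattice E] [IsOrderedAddMonoid E]
[IsOrderedModule ℝ E] [HasSolidNorm E]`.
Its norm dual `E'` is `StrongDual ℝ E`, which is given below its usual order (`f ≤ g` if and only if
`f x ≤ g x` for all `x ≥ 0`) and the lattice operations that belong to that order.
-/

noncomputable section

namespace BanachLattice

section DualLattice

variable {E : Type*} [NormedAddCommGroup E] [NormedSpace ℝ E] [Lattice E] [IsOrderedAddMonoid E]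
  [IsOrderedModule ℝ E] [HasSolidNorm E]

/-- The order of the dual: `f ≤ g` if and only if `f x ≤ g x` for all `x ≥ 0`. -/
instance dualPartialOrder : PartialOrder (StrongDual ℝ E) where
  le f g := ∀ x : E, 0 ≤ x → f x ≤ g x
  le_refl f x _ := le_rfl
  le_trans f g h hfg hgh x hx := (hfg x hx).trans (hgh x hx)
  le_antisymm f g hfg hgf := by
    have key : ∀ x : E, 0 ≤ x → f x = g x := fun x hx => le_antisymm (hfg x hx) (hgf x hx)
    ext x
    rw [← posPart_sub_negPart x, map_sub, map_sub, key _ (posPart_nonneg x),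
      key _ (negPart_nonneg x)]

theorem dual_le_def {f g : StrongDual ℝ E} : f ≤ g ↔ ∀ x : E, 0 ≤ x → f x ≤ g x := Iff.rfl

/-- The Riesz–Kantorovich expression for `(f ⊔ g) x` where `x ≥ 0`:
the supremum of `f y + g (x - y)` over `0 ≤ y ≤ x`. -/
def supOnCone (f g : StrongDual ℝ E) (x : E) : ℝ :=
  sSup ((fun y => f y + g (x - y)) '' Set.Icc 0 x)

theorem norm_le_of_mem_Icc {x y : E} (hy : y ∈ Set.Icc 0 x) : ‖y‖ ≤ ‖x‖ := by
  apply norm_le_norm_of_abs_le_abs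
  rw [abs_of_nonneg hy.1, abs_of_nonneg (hy.1.trans hy.2)]
  exact hy.2

theorem abs_apply_add_le (f g : StrongDual ℝ E) {x y : E} (hy : y ∈ Set.Icc 0 x) :
    |f y + g (x - y)| ≤ (‖f‖ + ‖g‖) * ‖x‖ := by
  have h1 : |f y| ≤ ‖f‖ * ‖x‖ :=
    (f.le_opNorm y).trans (mul_le_mul_of_nonneg_left (norm_le_of_mem_Icc hy) (norm_nonneg _))
  have hy' : x - y ∈ Set.Icc 0 x := ⟨sub_nonneg.2 hy.2, sub_le_self x hy.1⟩
  have h2 : |g (x - y)| ≤ ‖g‖ * ‖x‖ :=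
    (g.le_opNorm _).trans (mul_le_mul_of_nonneg_left (norm_le_of_mem_Icc hy') (norm_nonneg _))
  have h3 := abs_add_le (f y) (g (x - y))
  linarith [add_mul ‖f‖ ‖g‖ ‖x‖]

theorem bddAbove_supOnCone (f g : StrongDual ℝ E) (x : E) :
    BddAbove ((fun y => f y + g (x - y)) '' Set.Icc 0 x) := by
  refine ⟨(‖f‖ + ‖g‖) * ‖x‖, ?_⟩
  rintro _ ⟨y, hy, rfl⟩
  exact (le_abs_self _).trans (abs_apply_add_le f g hy)

theorem le_supOnCone (f g : StrongDual ℝ E) {x y : E} (hy : y ∈ Set.Icc 0 x) :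
    f y + g (x - y) ≤ supOnCone f g x :=
  le_csSup (bddAbove_supOnCone f g x) ⟨y, hy, rfl⟩

theorem supOnCone_le (f g : StrongDual ℝ E) {x : E} (hx : 0 ≤ x) {c : ℝ}
    (h : ∀ y ∈ Set.Icc 0 x, f y + g (x - y) ≤ c) : supOnCone f g x ≤ c := by
  refine csSup_le ⟨_, 0, ⟨le_rfl, hx⟩, rfl⟩ ?_
  rintro _ ⟨y, hy, rfl⟩
  exact h y hy

theorem supOnCone_zero (f g : StrongDual ℝ E) : supOnCone f g 0 = 0 := by
  simp [supOnCone]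

theorem abs_supOnCone_le (f g : StrongDual ℝ E) {x : E} (hx : 0 ≤ x) :
    |supOnCone f g x| ≤ (‖f‖ + ‖g‖) * ‖x‖ := by
  have h0 : (0 : E) ∈ Set.Icc 0 x := ⟨le_rfl, hx⟩
  rw [abs_le]
  constructor
  · exact (abs_le.1 (abs_apply_add_le f g h0)).1.trans (le_supOnCone f g h0)
  · exact supOnCone_le f g hx fun y hy => (abs_le.1 (abs_apply_add_le f g hy)).2

theorem supOnCone_add (f g : StrongDual ℝ E) {x z : E} (hx : 0 ≤ x) (hz : 0 ≤ z) :
    supOnCone f g (x + z) = supOnCone f g x + supOnCone f g z := by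
  apply le_antisymm
  · apply supOnCone_le f g (add_nonneg hx hz)
    intro y hy
    have h1 : y ⊓ x ∈ Set.Icc 0 x := ⟨le_inf hy.1 hx, inf_le_right⟩
    have h2 : y - y ⊓ x ∈ Set.Icc 0 z := by
      refine ⟨sub_nonneg.2 inf_le_left, ?_⟩
      rw [sub_le_iff_le_add, add_inf]
      exact le_inf (le_add_of_nonneg_left hz) (by rw [add_comm]; exact hy.2)
    have e1 := le_supOnCone f g h1
    have e2 := le_supOnCone f g h2
    simp only [map_sub, map_add] at e1 e2 ⊢
    linarith
  · rw [← le_sub_iff_add_le]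
    apply supOnCone_le f g hx
    intro y hy
    rw [le_sub_comm]
    apply supOnCone_le f g hz
    intro w hw
    have h : y + w ∈ Set.Icc 0 (x + z) := ⟨add_nonneg hy.1 hw.1, add_le_add hy.2 hw.2⟩
    have e := le_supOnCone f g h
    simp only [map_sub, map_add] at e ⊢
    linarith

/-- The supremum of two functionals, extended additively from the positive cone
through `x = x⁺ - x⁻`. -/
def dualSup (f g : StrongDual ℝ E) : StrongDual ℝ E :=
  AddMonoidHom.toRealLinearMap
    (AddMonoidHom.mk' (fun x => supOnCone f g x⁺ - supOnCone f g x⁻) (by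
      intro x z
      have e : (x + z)⁺ + (x⁻ + z⁻) = x⁺ + z⁺ + (x + z)⁻ := by
        have h1 := posPart_sub_negPart (x + z)
        have h2 := posPart_sub_negPart x
        have h3 := posPart_sub_negPart z
        have h4 : (x + z)⁺ = x + z + (x + z)⁻ := by rw [← sub_eq_iff_eq_add]; exact h1
        have h5 : x⁺ = x + x⁻ := by rw [← sub_eq_iff_eq_add]; exact h2
        have h6 : z⁺ = z + z⁻ := by rw [← sub_eq_iff_eq_add]; exact h3
        rw [h4, h5, h6]
        abel
      have h := congrArg (supOnCone f g) e
      rw [supOnCone_add f g (posPart_nonneg _) (add_nonneg (negPart_nonneg _) (negPart_nonneg _)),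
        supOnCone_add f g (negPart_nonneg _) (negPart_nonneg _),
        supOnCone_add f g (add_nonneg (posPart_nonneg _) (posPart_nonneg _)) (negPart_nonneg _),
        supOnCone_add f g (posPart_nonneg _) (posPart_nonneg _)] at h
      linarith))
    (AddMonoidHomClass.continuous_of_bound _ (2 * (‖f‖ + ‖g‖)) (by
      intro x
      have h1 := abs_supOnCone_le f g (posPart_nonneg x)
      have h2 := abs_supOnCone_le f g (negPart_nonneg x)
      have h3 : ‖x⁺‖ ≤ ‖x‖ := by
        apply norm_le_norm_of_abs_le_abs
        rw [abs_of_nonneg (posPart_nonneg x)]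
        exact sup_le (le_abs_self x) (abs_nonneg x)
      have h4 : ‖x⁻‖ ≤ ‖x‖ := by
        apply norm_le_norm_of_abs_le_abs
        rw [abs_of_nonneg (negPart_nonneg x)]
        exact sup_le (neg_le_abs x) (abs_nonneg x)
      have hc : 0 ≤ ‖f‖ + ‖g‖ := by positivity
      have h5 := mul_le_mul_of_nonneg_left h3 hc
      have h6 := mul_le_mul_of_nonneg_left h4 hc
      have h7 := abs_sub (supOnCone f g x⁺) (supOnCone f g x⁻)
      change |supOnCone f g x⁺ - supOnCone f g x⁻| ≤ _
      linarith))

theorem dualSup_apply_of_nonneg (f g : StrongDual ℝ E) {x : E} (hx : 0 ≤ x) :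
    dualSup f g x = sSup ((fun y => f y + g (x - y)) '' Set.Icc 0 x) := by
  change supOnCone f g x⁺ - supOnCone f g x⁻ = supOnCone f g x
  rw [posPart_eq_self.2 hx, negPart_eq_zero.2 hx, supOnCone_zero, sub_zero]

theorem le_dualSup_left (f g : StrongDual ℝ E) : f ≤ dualSup f g := by
  intro x hx
  rw [dualSup_apply_of_nonneg f g hx]
  have h := le_supOnCone f g (x := x) (y := x) ⟨hx, le_rfl⟩
  rwa [sub_self, map_zero, add_zero] at h

theorem le_dualSup_right (f g : StrongDual ℝ E) : g ≤ dualSup f g := by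
  intro x hx
  rw [dualSup_apply_of_nonneg f g hx]
  have h := le_supOnCone f g (x := x) (y := 0) ⟨le_rfl, hx⟩
  rwa [sub_zero, map_zero, zero_add] at h

theorem dualSup_le {f g h : StrongDual ℝ E} (hf : f ≤ h) (hg : g ≤ h) : dualSup f g ≤ h := by
  intro x hx
  rw [dualSup_apply_of_nonneg f g hx]
  apply supOnCone_le f g hx
  intro y hy
  have h1 := hf y hy.1
  have h2 := hg (x - y) (sub_nonneg.2 hy.2)
  rw [map_sub h] at h2
  linarith

theorem dual_neg_le_neg {f g : StrongDual ℝ E} (h : f ≤ g) : -g ≤ -f :=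
  fun x hx => neg_le_neg (h x hx)

/-- The dual of a Banach lattice as a lattice. -/
instance dualLattice : Lattice (StrongDual ℝ E) where
  toPartialOrder := dualPartialOrder
  sup := dualSup
  le_sup_left := le_dualSup_left
  le_sup_right := le_dualSup_right
  sup_le _ _ _ := dualSup_le
  inf f g := -dualSup (-f) (-g)
  inf_le_left f g := by
    simpa only [neg_neg] using dual_neg_le_neg (le_dualSup_left (-f) (-g))
  inf_le_right f g := by
    simpa only [neg_neg] using dual_neg_le_neg (le_dualSup_right (-f) (-g))
  le_inf f g h hfg hfh := by
    simpa only [neg_neg] using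
      dual_neg_le_neg (dualSup_le (dual_neg_le_neg hfg) (dual_neg_le_neg hfh))

instance dualIsOrderedAddMonoid : IsOrderedAddMonoid (StrongDual ℝ E) where
  add_le_add_left f g hfg h x hx := by
    simpa using hfg x hx

end DualLattice

section Notions

variable {E : Type*} [NormedAddCommGroup E] [NormedSpace ℝ E]

/-- The sequence `f` in the dual converges to zero in the weak* topology. -/
def IsWeakStarNull (f : ℕ → StrongDual ℝ E) : Prop :=
  Tendsto (fun n => StrongDual.toWeakDual (f n)) atTop (𝓝 0)

variable [Lattice E] [IsOrderedAddMonoid E] [IsOrderedModule ℝ E] [HasSolidNorm E]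

/-- A sequence in the dual is disjoint if `|f m| ⊓ |f n| = 0` for all `m ≠ n`. -/
def IsDisjointSeq (f : ℕ → StrongDual ℝ E) : Prop :=
  Pairwise fun m n => |f m| ⊓ |f n| = 0

variable (E) in
/-- Property (d): `|f n|` is weak* null for every disjoint weak* null sequence `f` in the dual. -/
def HasPropertyD : Prop :=
  ∀ f : ℕ → StrongDual ℝ E, IsDisjointSeq f → IsWeakStarNull f → IsWeakStarNull fun n => |f n|

/-- A norm bounded set is almost limited if every disjoint weak* null sequence in the dual
converges to zero uniformly on it. -/
def IsAlmostLimited (A : Set E) : Prop :=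
  Bornology.IsBounded A ∧
    ∀ f : ℕ → StrongDual ℝ E, IsDisjointSeq f → IsWeakStarNull f →
      TendstoUniformlyOn (fun n x => f n x) (fun _ => 0) atTop A

end Notions

/-- A linear operator is order bounded if it maps order bounded sets to order bounded sets. -/
def IsOrderBounded {E F : Type*} [AddCommGroup E] [Module ℝ E] [Preorder E] [AddCommGroup F]
    [Module ℝ F] [Preorder F] (T : E →ₗ[ℝ] F) : Prop :=
  ∀ s : Set E, BddBelow s → BddAbove s → BddBelow (T '' s) ∧ BddAbove (T '' s)

end BanachLattice

end

set_option linter.unusedSectionVars false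

namespace BanachLattice

/-! ### Disjointness in lattice-ordered groups. -/

section LatticeGroup

variable {G : Type*} [AddCommGroup G] [Lattice G] [IsOrderedAddMonoid G]

/-! Let `f n` be disjoint and weak* null in `F'`. Property (d) makes `|f n|` weak* null, and since
`T` sends `[-x, x]` into some `[-u, u]`, `|(f n).comp T| x ≤ |f n| u`, so `|(f n).comp T|` is weak*
null too. These functionals need not be disjoint, so the definition of almost limited does not apply
to them directly. `IsAlmostLimited.tendstoUniformlyOn_of_abs` removes this obstacle.

If uniform convergence failed on the solid set `A`, a subsequence would give positive weak* null `g
k` and positive `x k ∈ A` with `ε ≤ g k (x k)`. Thinned further, it makes `g k` tiny at earlier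
points, and disjointification yields disjoint `0 ≤ y k ≤ x k`, in `A` by solidity, still with `g k
(y k) > ε / 2`. Restricting `g k` to the band of `y k` gives disjoint `0 ≤ h k ≤ g k` with `h k (y
k) = g k (y k)`. The `h k` are weak* null, contradicting that `A` is almost limited. -/

theorem add_inf_le_add_inf {a b c : G} (ha : 0 ≤ a) (hb : 0 ≤ b) (hc : 0 ≤ c) :
    (a + b) ⊓ c ≤ a ⊓ c + b ⊓ c := by
  rw [inf_add, add_inf, add_inf]
  exact le_inf (le_inf inf_le_left (inf_le_right.trans (le_add_of_nonneg_left ha)))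
    (le_inf (inf_le_right.trans (le_add_of_nonneg_right hb))
      (inf_le_right.trans (le_add_of_nonneg_left hc)))

theorem nsmul_inf_eq_zero {a b : G} (ha : 0 ≤ a) (hb : 0 ≤ b) (h : a ⊓ b = 0) (n : ℕ) :
    (n • a) ⊓ b = 0 := by
  induction n with
  | zero => simpa using hb
  | succ n ih =>
    refine le_antisymm ?_ (le_inf (nsmul_nonneg ha _) hb)
    rw [succ_nsmul]
    simpa [ih, h] using add_inf_le_add_inf (nsmul_nonneg ha n) ha hb

theorem nsmul_inf_nsmul_eq_zero {a b : G} (ha : 0 ≤ a) (hb : 0 ≤ b) (h : a ⊓ b = 0) (m n : ℕ) :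
    (m • a) ⊓ (n • b) = 0 := by
  have h1 := nsmul_inf_eq_zero ha hb h m
  rw [inf_comm] at h1 ⊢
  exact nsmul_inf_eq_zero hb (nsmul_nonneg ha m) h1 n

end LatticeGroup

/-! ### Positive functionals, moduli and band components in the dual. -/

section Dual

variable {E : Type*} [NormedAddCommGroup E] [NormedSpace ℝ E] [Lattice E] [IsOrderedAddMonoid E]
  [IsOrderedModule ℝ E] [HasSolidNorm E]

theorem isWeakStarNull_iff {f : ℕ → StrongDual ℝ E} :
    IsWeakStarNull f ↔ ∀ x, Tendsto (fun n => f n x) atTop (𝓝 0) :=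
  tendsto_iff_forall_eval_tendsto_topDualPairing

theorem isWeakStarNull_iff_of_nonneg {f : ℕ → StrongDual ℝ E} :
    IsWeakStarNull f ↔ ∀ x, 0 ≤ x → Tendsto (fun n => f n x) atTop (𝓝 0) := by
  rw [isWeakStarNull_iff]
  refine ⟨fun h x _ => h x, fun h x => ?_⟩
  have := (h x⁺ (posPart_nonneg x)).sub (h x⁻ (negPart_nonneg x))
  simpa [← map_sub] using this

theorem norm_posPart_le (x : E) : ‖x⁺‖ ≤ ‖x‖ := by
  apply norm_le_norm_of_abs_le_abs
  rw [abs_of_nonneg (posPart_nonneg x)]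
  exact sup_le (le_abs_self x) (abs_nonneg x)

theorem norm_negPart_le (x : E) : ‖x⁻‖ ≤ ‖x‖ := by
  apply norm_le_norm_of_abs_le_abs
  rw [abs_of_nonneg (negPart_nonneg x)]
  exact sup_le (neg_le_abs x) (abs_nonneg x)

/-- A bounded additive function on the positive cone extends to a continuous functional. -/
theorem exists_dual_eq_on_cone (p : E → ℝ) (C : ℝ)
    (hadd : ∀ x z : E, 0 ≤ x → 0 ≤ z → p (x + z) = p x + p z)
    (hbound : ∀ x : E, 0 ≤ x → |p x| ≤ C * ‖x‖) :
    ∃ f : StrongDual ℝ E, ∀ x, 0 ≤ x → f x = p x := by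
  have hC : ∀ x : E, 0 ≤ x → |p x| ≤ |C| * ‖x‖ := fun x hx =>
    (hbound x hx).trans (mul_le_mul_of_nonneg_right (le_abs_self C) (norm_nonneg x))
  let φ : E →+ ℝ := AddMonoidHom.mk' (fun x => p x⁺ - p x⁻) (by
    intro x z
    have e : (x + z)⁺ + (x⁻ + z⁻) = x⁺ + z⁺ + (x + z)⁻ := by
      have h4 : (x + z)⁺ = x + z + (x + z)⁻ := by
        rw [← sub_eq_iff_eq_add]; exact posPart_sub_negPart (x + z)
      have h5 : x⁺ = x + x⁻ := by rw [← sub_eq_iff_eq_add]; exact posPart_sub_negPart x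
      have h6 : z⁺ = z + z⁻ := by rw [← sub_eq_iff_eq_add]; exact posPart_sub_negPart z
      rw [h4, h5, h6]
      abel
    have h := congrArg p e
    rw [hadd _ _ (posPart_nonneg _) (add_nonneg (negPart_nonneg _) (negPart_nonneg _)),
      hadd _ _ (negPart_nonneg _) (negPart_nonneg _),
      hadd _ _ (add_nonneg (posPart_nonneg _) (posPart_nonneg _)) (negPart_nonneg _),
      hadd _ _ (posPart_nonneg _) (posPart_nonneg _)] at h
    linarith)
  have hφ : Continuous φ := AddMonoidHomClass.continuous_of_bound φ (2 * |C|) (by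
    intro x
    have h1 := hC _ (posPart_nonneg x)
    have h2 := hC _ (negPart_nonneg x)
    have h5 := mul_le_mul_of_nonneg_left (norm_posPart_le x) (abs_nonneg C)
    have h6 := mul_le_mul_of_nonneg_left (norm_negPart_le x) (abs_nonneg C)
    have h7 := abs_sub (p x⁺) (p x⁻)
    change |p x⁺ - p x⁻| ≤ _
    linarith)
  refine ⟨AddMonoidHom.toRealLinearMap φ hφ, fun x hx => ?_⟩
  change p x⁺ - p x⁻ = p x
  have h0 : p 0 = 0 := by simpa using hadd 0 0 le_rfl le_rfl
  rw [posPart_eq_self.2 hx, negPart_eq_zero.2 hx, h0, sub_zero]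

theorem dual_apply_mono {f : StrongDual ℝ E} (hf : 0 ≤ f) {x y : E} (h : x ≤ y) : f x ≤ f y := by
  have := hf (y - x) (sub_nonneg.2 h)
  rw [map_sub f] at this
  exact sub_nonneg.1 this

theorem abs_apply_le (f : StrongDual ℝ E) (x : E) : |f x| ≤ |f| |x| := by
  have h1 : f ≤ |f| := le_abs_self f
  have h2 : -f ≤ |f| := neg_le_abs f
  have hx := h1 _ (posPart_nonneg x)
  have hx' := h1 _ (negPart_nonneg x)
  have hy := h2 _ (posPart_nonneg x)
  have hy' := h2 _ (negPart_nonneg x)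
  have e : f x = f x⁺ - f x⁻ := by rw [← map_sub, posPart_sub_negPart]
  have e' : |f| |x| = |f| x⁺ + |f| x⁻ := by rw [← map_add, posPart_add_negPart]
  simp only [neg_apply] at hy hy'
  rw [e, e', abs_le]
  constructor <;> linarith

/-- In the Riesz–Kantorovich formula for `f ⊔ -f`, each term is `f (2y - x)` with `0 ≤ y ≤ x`, and
`|2y - x| ≤ x`. -/
theorem abs_dual_apply_le {f : StrongDual ℝ E} {x : E} (hx : 0 ≤ x) {c : ℝ}
    (h : ∀ y, |y| ≤ x → f y ≤ c) : |f| x ≤ c := by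
  change dualSup f (-f) x ≤ c
  rw [dualSup_apply_of_nonneg f (-f) hx]
  apply supOnCone_le f (-f) hx
  intro y hy
  have : f y + (-f) (x - y) = f (y - (x - y)) := by simp [sub_eq_add_neg]
  rw [this]
  refine h _ (abs_le'.2 ⟨?_, ?_⟩)
  · have := add_le_add hy.2 hy.2
    have e : y - (x - y) = (y + y) - x := by abel
    rw [e, sub_le_iff_le_add]
    exact this
  · have e : -(y - (x - y)) = x - (y + y) := by abel
    rw [e]
    exact sub_le_self _ (add_nonneg hy.1 hy.1)

/-- Split `x = (x - u) + u` and bound `f ⊓ g` by `f` on the first piece and by `g` on the second. -/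
theorem dual_inf_eq_zero {f g : StrongDual ℝ E} (hf : 0 ≤ f) (hg : 0 ≤ g)
    (h : ∀ x, 0 ≤ x → ∀ ε > 0, ∃ u ∈ Set.Icc 0 x, f (x - u) + g u ≤ ε) : f ⊓ g = 0 := by
  refine le_antisymm (fun x hx => ?_) (le_inf hf hg)
  refine le_of_forall_pos_le_add fun ε hε => ?_
  obtain ⟨u, hu, hle⟩ := h x hx ε hε
  have h1 : (f ⊓ g) (x - u) ≤ f (x - u) :=
    (inf_le_left : f ⊓ g ≤ f) _ (sub_nonneg.2 hu.2)
  have h2 : (f ⊓ g) u ≤ g u := (inf_le_right : f ⊓ g ≤ g) _ hu.1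
  rw [map_sub] at h1
  change (f ⊓ g) x ≤ 0 + ε
  linarith

/-- The component of a positive functional `g` carried by the principal band of `y ≥ 0`. -/
theorem exists_band_component {g : StrongDual ℝ E} (hg : 0 ≤ g) {y : E} (hy : 0 ≤ y) :
    ∃ h : StrongDual ℝ E, 0 ≤ h ∧ h ≤ g ∧
      ∀ x, 0 ≤ x → IsLUB (Set.range fun m : ℕ => g (x ⊓ m • y)) (h x) := by
  have hpos : ∀ x, 0 ≤ x → 0 ≤ g x := fun x hx => hg x hx
  have hbdd : ∀ x, BddAbove (Set.range fun m : ℕ => g (x ⊓ m • y)) := fun x =>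
    ⟨g x, by rintro _ ⟨m, rfl⟩; exact dual_apply_mono hg inf_le_left⟩
  have hlub : ∀ x, IsLUB (Set.range fun m : ℕ => g (x ⊓ m • y)) (⨆ m : ℕ, g (x ⊓ m • y)) :=
    fun x => isLUB_ciSup (hbdd x)
  have hle : ∀ x, (⨆ m : ℕ, g (x ⊓ m • y)) ≤ g x := fun x =>
    ciSup_le fun m => dual_apply_mono hg inf_le_left
  have hnn : ∀ x, 0 ≤ x → 0 ≤ ⨆ m : ℕ, g (x ⊓ m • y) := fun x hx =>
    (hpos _ (le_inf hx (nsmul_nonneg hy 0))).trans (le_ciSup (hbdd x) 0)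
  obtain ⟨h, hh⟩ := exists_dual_eq_on_cone (fun x => ⨆ m : ℕ, g (x ⊓ m • y)) ‖g‖ (by
    intro x z hx hz
    apply le_antisymm
    · refine ciSup_le fun m => ?_
      have h1 := dual_apply_mono hg (add_inf_le_add_inf hx hz (nsmul_nonneg hy m))
      rw [map_add] at h1
      exact h1.trans (add_le_add (le_ciSup (hbdd x) m) (le_ciSup (hbdd z) m))
    · refine ciSup_add_ciSup_le fun m n => ?_
      -- Truncations at `m • y` and `n • y` add up to an element below `(m + n) • y`.
      refine le_trans ?_ (le_ciSup (hbdd (x + z)) (m + n))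
      rw [← map_add]
      refine dual_apply_mono hg (le_inf (add_le_add inf_le_left inf_le_left) ?_)
      rw [add_nsmul]
      exact add_le_add inf_le_right inf_le_right) (by
    intro x hx
    rw [abs_of_nonneg (hnn x hx)]
    exact (hle x).trans ((le_abs_self _).trans (g.le_opNorm x)))
  refine ⟨h, fun x hx => ?_, fun x hx => ?_, fun x hx => ?_⟩
  · rw [hh x hx]; exact hnn x hx
  · rw [hh x hx]; exact hle x
  · rw [hh x hx]; exact hlub x

/-- Positive functionals `g n` dominate disjoint positive functionals that agree with `g n` at `y n`
when `y` is a disjoint positive sequence. -/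
theorem exists_disjointSeq_dual {g : ℕ → StrongDual ℝ E} (hg : ∀ n, 0 ≤ g n) {y : ℕ → E}
    (hy : ∀ n, 0 ≤ y n) (hdisj : Pairwise fun m n => y m ⊓ y n = 0) :
    ∃ h : ℕ → StrongDual ℝ E, IsDisjointSeq h ∧
      ∀ n, 0 ≤ h n ∧ h n ≤ g n ∧ h n (y n) = g n (y n) := by
  choose h h0 hle hlub using fun n => exists_band_component (hg n) (hy n)
  refine ⟨h, fun m n hmn => ?_, fun n => ⟨h0 n, hle n, ?_⟩⟩
  · change |h m| ⊓ |h n| = 0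
    rw [abs_of_nonneg (h0 m), abs_of_nonneg (h0 n)]
    refine dual_inf_eq_zero (h0 m) (h0 n) fun x hx ε hε => ?_
    -- The splitting element is `u = x ⊓ k • y m`: `h m` nearly exhausts its value at `x` there,
    -- while `h n` vanishes on it.
    obtain ⟨_, ⟨k, rfl⟩, hk, -⟩ := (hlub m x hx).exists_between (sub_lt_self (h m x) hε)
    have hu : 0 ≤ x ⊓ k • y m := le_inf hx (nsmul_nonneg (hy m) k)
    refine ⟨x ⊓ k • y m, ⟨hu, inf_le_left⟩, ?_⟩
    have h1 : h n (x ⊓ k • y m) ≤ 0 := by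
      refine (hlub n _ hu).2 ?_
      rintro _ ⟨j, rfl⟩
      have e : x ⊓ k • y m ⊓ j • y n = 0 := by
        rw [inf_assoc, nsmul_inf_nsmul_eq_zero (hy m) (hy n) (hdisj hmn), inf_eq_right.2 hx]
      simp [e]
    have h2 : g m (x ⊓ k • y m) ≤ h m (x ⊓ k • y m) :=
      (hlub m _ hu).1 ⟨k, by simp⟩
    rw [map_sub]
    linarith
  · refine le_antisymm (hle n _ (hy n)) ((hlub n _ (hy n)).1 ⟨1, by simp⟩)

end Dual

/-! ### Disjointification of a positive sequence. -/

section Disjointification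

variable {E : Type*} [AddCommGroup E] [Module ℝ E] [Lattice E] [IsOrderedAddMonoid E]
  [IsOrderedModule ℝ E]

/-- Classical disjointification of a positive sequence `x` whose terms satisfy
`(1 / 2) ^ n • x n ≤ s`. -/
noncomputable def disjointify (x : ℕ → E) (s : E) (n : ℕ) : E :=
  (x n - (4 : ℝ) ^ n • ∑ i ∈ Finset.range n, x i - (1 / 2 : ℝ) ^ n • s)⁺

theorem disjointify_nonneg (x : ℕ → E) (s : E) (n : ℕ) : 0 ≤ disjointify x s n :=
  posPart_nonneg _

theorem le_disjointify (x : ℕ → E) (s : E) (n : ℕ) :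
    x n - (4 : ℝ) ^ n • ∑ i ∈ Finset.range n, x i - (1 / 2 : ℝ) ^ n • s ≤ disjointify x s n :=
  le_posPart _

theorem disjointify_le {x : ℕ → E} {s : E} (hx : ∀ n, 0 ≤ x n) (hs : 0 ≤ s) (n : ℕ) :
    disjointify x s n ≤ x n := by
  refine sup_le ?_ (hx n)
  refine (sub_le_self _ (smul_nonneg (by positivity) hs)).trans (sub_le_self _ ?_)
  exact smul_nonneg (by positivity) (Finset.sum_nonneg fun i _ => hx i)

/-- The two terms lie below `a⁻` and `a⁺` for `a = x l - 4 ^ l • x k`. The subtracted sum gives the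
bound by `a⁺`, the subtracted multiple of `s` the bound by `a⁻`. -/
theorem disjointify_inf_eq_zero_of_lt {x : ℕ → E} {s : E} (hx : ∀ n, 0 ≤ x n)
    (hs : ∀ n, (1 / 2 : ℝ) ^ n • x n ≤ s) {k l : ℕ} (hkl : k < l) :
    disjointify x s k ⊓ disjointify x s l = 0 := by
  have hs0 : 0 ≤ s := (smul_nonneg (by positivity) (hx 0)).trans (hs 0)
  set a : E := x l - (4 : ℝ) ^ l • x k with ha
  have hl : disjointify x s l ≤ a⁺ := by
    apply posPart_mono
    refine (sub_le_self _ (smul_nonneg (by positivity) hs0)).trans (sub_le_sub_left ?_ _)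
    exact smul_le_smul_of_nonneg_left
      (Finset.single_le_sum (fun i _ => hx i) (Finset.mem_range.2 hkl)) (by positivity)
  have hk : disjointify x s k ≤ a⁻ := by
    refine sup_le ?_ (negPart_nonneg a)
    have h1 : (1 / 2 : ℝ) ^ (k + l) • x l ≤ (1 / 2 : ℝ) ^ k • s := by
      rw [pow_add, mul_smul]
      exact smul_le_smul_of_nonneg_left (hs l) (by positivity)
    -- Since `k < l`, `2 ^ (k + l) ≤ 4 ^ l`.
    have h2 : x k ≤ (1 / 2 : ℝ) ^ (k + l) • (4 : ℝ) ^ l • x k := by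
      rw [smul_smul]
      refine le_smul_of_one_le_left (hx k) ?_
      have : (4 : ℝ) ^ l = 2 ^ (l + l) := by rw [← two_mul, pow_mul]; norm_num
      rw [this, one_div, inv_pow, ← div_eq_inv_mul, le_div_iff₀ (by positivity), one_mul]
      exact pow_le_pow_right₀ one_le_two (by omega)
    have h3 : -a ≤ a⁻ := neg_le_negPart a
    calc x k - (4 : ℝ) ^ k • ∑ i ∈ Finset.range k, x i - (1 / 2 : ℝ) ^ k • s
        ≤ x k - (1 / 2 : ℝ) ^ k • s := sub_le_sub_right
          (sub_le_self _ (smul_nonneg (by positivity) (Finset.sum_nonneg fun i _ => hx i))) _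
      _ ≤ (1 / 2 : ℝ) ^ (k + l) • (4 : ℝ) ^ l • x k - (1 / 2 : ℝ) ^ (k + l) • x l :=
          sub_le_sub h2 h1
      _ = (1 / 2 : ℝ) ^ (k + l) • (-a) := by rw [ha, neg_sub, smul_sub]
      _ ≤ (1 / 2 : ℝ) ^ (k + l) • a⁻ := smul_le_smul_of_nonneg_left h3 (by positivity)
      _ ≤ a⁻ := smul_le_of_le_one_left (negPart_nonneg a)
          (pow_le_one₀ (by norm_num) (by norm_num))
  refine le_antisymm ((inf_le_inf hk hl).trans ?_)
    (le_inf (disjointify_nonneg x s k) (disjointify_nonneg x s l))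
  rw [inf_comm, posPart_inf_negPart_eq_zero]

theorem pairwise_disjointify {x : ℕ → E} {s : E} (hx : ∀ n, 0 ≤ x n)
    (hs : ∀ n, (1 / 2 : ℝ) ^ n • x n ≤ s) :
    Pairwise fun m n => disjointify x s m ⊓ disjointify x s n = 0 := by
  intro m n hmn
  rcases hmn.lt_or_gt with h | h
  · exact disjointify_inf_eq_zero_of_lt hx hs h
  · rw [inf_comm]
    exact disjointify_inf_eq_zero_of_lt hx hs h

end Disjointification

/-- A subsequence along which `G n` is small on all earlier points, with geometric weights. -/
theorem exists_strictMono_of_forall_tendsto {α : Type*} {G : ℕ → α → ℝ} {x : ℕ → α}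
    (hG : ∀ i, Tendsto (fun n => G n (x i)) atTop (𝓝 0)) {ε : ℝ} (hε : 0 < ε) :
    ∃ φ : ℕ → ℕ, StrictMono φ ∧
      ∀ k, (4 : ℝ) ^ k * ∑ i ∈ Finset.range k, G (φ k) (x (φ i)) ≤ ε := by
  -- Here `m` plays the role of `φ k`. As `k ≤ m`, the factor `m + 1` covers the `k + 1` earlier
  -- points and `4 ^ (m + 1)` covers the weight `4 ^ (k + 1)`.
  have key : ∀ m : ℕ, ∃ n > m, ∀ i ≤ m, (4 : ℝ) ^ (m + 1) * ((m + 1) * |G n (x i)|) ≤ ε := by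
    intro m
    have h : ∀ i ∈ Set.Iic m, ∀ᶠ n in atTop, (4 : ℝ) ^ (m + 1) * ((m + 1) * |G n (x i)|) ≤ ε := by
      intro i _
      have := (((hG i).abs.const_mul ((m : ℝ) + 1)).const_mul ((4 : ℝ) ^ (m + 1)))
      simp only [abs_zero, mul_zero] at this
      exact this.eventually_le_const hε
    have h' := ((Set.finite_Iic m).eventually_all).2 h
    obtain ⟨n, hn, hn'⟩ := (h'.and (eventually_gt_atTop m)).exists
    exact ⟨n, hn', hn⟩
  choose N hN hle using key
  have hmono : StrictMono fun k => N^[k] 0 := strictMono_nat_of_lt_succ fun k => by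
    rw [Function.iterate_succ_apply']; exact hN _
  refine ⟨fun k => N^[k] 0, hmono, fun k => ?_⟩
  cases k with
  | zero => simpa using hε.le
  | succ k =>
    set m := N^[k] 0 with hm
    have hkm : k ≤ m := hmono.le_apply
    have hb : ∀ i ∈ Finset.range (k + 1),
        G (N^[k + 1] 0) (x (N^[i] 0)) ≤ ε / ((4 : ℝ) ^ (m + 1) * (m + 1)) := by
      intro i hi
      have him : N^[i] 0 ≤ m := hmono.monotone (Nat.lt_succ_iff.1 (Finset.mem_range.1 hi))
      rw [Function.iterate_succ_apply', le_div_iff₀ (by positivity), mul_comm, mul_assoc]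
      refine le_trans ?_ (hle m _ him)
      gcongr
      exact le_abs_self _
    have hsum := Finset.sum_le_card_nsmul _ _ _ hb
    rw [Finset.card_range, nsmul_eq_mul] at hsum
    calc (4 : ℝ) ^ (k + 1) * ∑ i ∈ Finset.range (k + 1), G (N^[k + 1] 0) (x (N^[i] 0))
        ≤ (4 : ℝ) ^ (m + 1) * (((m : ℝ) + 1) * (ε / ((4 : ℝ) ^ (m + 1) * (m + 1)))) := by
          refine (mul_le_mul_of_nonneg_left hsum (by positivity)).trans ?_
          push_cast
          gcongr
          norm_num
      _ = ε := by field_simp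

/-! ### Order bounded operators and solid almost limited sets. -/

section BanachLattice

variable {E : Type*} [NormedAddCommGroup E] [NormedSpace ℝ E] [CompleteSpace E] [Lattice E]
  [IsOrderedAddMonoid E] [IsOrderedModule ℝ E] [HasSolidNorm E]

theorem exists_forall_geometric_smul_le {x : ℕ → E} (hx : ∀ n, 0 ≤ x n) {C : ℝ}
    (hC : ∀ n, ‖x n‖ ≤ C) : ∃ s, ∀ n, (1 / 2 : ℝ) ^ n • x n ≤ s := by
  have hsum : Summable fun n => (1 / 2 : ℝ) ^ n • x n := by
    refine Summable.of_norm_bounded (summable_geometric_two.mul_right C) fun n => ?_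
    rw [norm_smul, norm_pow]
    have : ‖(1 / 2 : ℝ)‖ = 1 / 2 := by norm_num
    rw [this]
    exact mul_le_mul_of_nonneg_left (hC n) (by positivity)
  exact ⟨_, fun n => hsum.le_tsum n fun j _ => smul_nonneg (by positivity) (hx j)⟩

/-- An order bounded operator from a Banach lattice to a lattice-normed space is continuous. -/
theorem IsOrderBounded.continuous {F : Type*} [NormedAddCommGroup F] [NormedSpace ℝ F] [Lattice F]
    [IsOrderedAddMonoid F] [HasSolidNorm F] {T : E →ₗ[ℝ] F} (hT : IsOrderBounded T) :
    Continuous T := by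
  suffices h : ∃ C, ∀ x ∈ Metric.ball (0 : E) 1, ‖T x‖ ≤ C by
    obtain ⟨C, hC⟩ := h
    obtain ⟨D, hD⟩ := LinearMap.bound_of_ball_bound one_pos C T hC
    exact AddMonoidHomClass.continuous_of_bound T D hD
  by_contra! hcon
  -- The factor `2 ^ n` offsets the scaling by `(1 / 2) ^ n` that puts all the vectors in one order
  -- interval, leaving images of norm at least `n`.
  choose x hx hTx using fun n : ℕ => hcon (n * 2 ^ n)
  obtain ⟨s, hs⟩ := exists_forall_geometric_smul_le (x := fun n => |x n|) (C := 1)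
    (fun n => abs_nonneg _) (fun n => by
      rw [norm_abs_eq_norm]; exact (mem_ball_zero_iff.1 (hx n)).le)
  obtain ⟨⟨b, hb⟩, ⟨c, hc⟩⟩ := hT (Set.Icc (-s) s) bddBelow_Icc bddAbove_Icc
  obtain ⟨n, hn⟩ := exists_nat_gt ‖|b| ⊔ |c|‖
  have hmem : (1 / 2 : ℝ) ^ n • x n ∈ Set.Icc (-s) s := by
    have hp : (0 : ℝ) ≤ (1 / 2) ^ n := by positivity
    constructor
    · rw [neg_le, ← smul_neg]
      exact (smul_le_smul_of_nonneg_left (neg_le_abs (x n)) hp).trans (hs n)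
    · exact (smul_le_smul_of_nonneg_left (le_abs_self (x n)) hp).trans (hs n)
  have h1 := hb ⟨_, hmem, rfl⟩
  have h2 := hc ⟨_, hmem, rfl⟩
  have h3 : ‖T ((1 / 2 : ℝ) ^ n • x n)‖ ≤ ‖|b| ⊔ |c|‖ := by
    apply norm_le_norm_of_abs_le_abs
    rw [abs_of_nonneg ((abs_nonneg b).trans le_sup_left)]
    refine abs_le'.2 ⟨h2.trans ((le_abs_self c).trans le_sup_right), ?_⟩
    exact (neg_le_neg h1).trans ((neg_le_abs b).trans le_sup_left)
  have h4 : (n : ℝ) ≤ ‖T ((1 / 2 : ℝ) ^ n • x n)‖ := by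
    rw [map_smul, norm_smul, norm_pow]
    have : ‖(1 / 2 : ℝ)‖ = 1 / 2 := by norm_num
    rw [this, one_div, inv_pow, ← div_eq_inv_mul, le_div_iff₀ (by positivity)]
    exact (hTx n).le
  linarith

/-- On a solid almost limited set, `f n → 0` uniformly as soon as `|f n|` is weak* null,
without any disjointness assumption. -/
theorem IsAlmostLimited.tendstoUniformlyOn_of_abs {A : Set E}
    (hA : IsAlmostLimited A) (hsolid : LatticeOrderedAddCommGroup.IsSolid A)
    {f : ℕ → StrongDual ℝ E} (hf : IsWeakStarNull fun n => |f n|) :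
    TendstoUniformlyOn (fun n x => f n x) (fun _ => 0) atTop A := by
  rw [Metric.tendstoUniformlyOn_iff]
  by_contra! hcon
  obtain ⟨ε, hε, hfreq⟩ := hcon
  obtain ⟨ψ, hψ, hψA⟩ := extraction_of_frequently_atTop hfreq
  choose z hzA hz using hψA
  have hnull := isWeakStarNull_iff.1 hf
  obtain ⟨φ, hφ, hφle⟩ := exists_strictMono_of_forall_tendsto
    (G := fun n v => |f (ψ n)| v) (x := fun n => |z n|)
    (fun i => (hnull |z i|).comp hψ.tendsto_atTop) (ε := ε / 4) (by positivity)
  set g : ℕ → StrongDual ℝ E := fun k => |f (ψ (φ k))| with hg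
  set x : ℕ → E := fun k => |z (φ k)| with hx
  have hx0 : ∀ k, 0 ≤ x k := fun k => abs_nonneg _
  have hxA : ∀ k, x k ∈ A := fun k => hsolid (hzA (φ k)) (by rw [hx, abs_abs])
  have hgx : ∀ k, ε ≤ g k (x k) := fun k => by
    have h1 := hz (φ k)
    rw [dist_zero_left, Real.norm_eq_abs] at h1
    exact h1.trans (abs_apply_le _ _)
  have hgnull : ∀ v, Tendsto (fun k => g k v) atTop (𝓝 0) := fun v =>
    (hnull v).comp (hψ.comp hφ).tendsto_atTop
  obtain ⟨C, hC⟩ := hA.1.exists_norm_le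
  obtain ⟨s, hs⟩ := exists_forall_geometric_smul_le hx0 fun k => hC _ (hxA k)
  have hs0 : 0 ≤ s := (smul_nonneg (by positivity) (hx0 0)).trans (hs 0)
  have hg0 : ∀ k, 0 ≤ g k := fun k => abs_nonneg _
  obtain ⟨h, hdisj, hh⟩ := exists_disjointSeq_dual hg0 (disjointify_nonneg x s)
    (pairwise_disjointify hx0 hs)
  have hhnull : IsWeakStarNull h := isWeakStarNull_iff_of_nonneg.2 fun v hv =>
    squeeze_zero (fun k => (hh k).1 v hv) (fun k => (hh k).2.1 v hv) (hgnull v)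
  -- Disjointification costs at most `ε / 4` for the earlier points and less than `ε / 4` for `s`,
  -- so more than `ε / 2` of `g k (x k)` survives.
  have hunif := Metric.tendstoUniformlyOn_iff.1 (hA.2 h hdisj hhnull) (ε / 2) (by positivity)
  have hsmall := (hgnull s).eventually_lt_const (show (0 : ℝ) < ε / 4 by positivity)
  obtain ⟨k, hk, hk'⟩ := (hunif.and hsmall).exists
  have hyA : disjointify x s k ∈ A := hsolid (hxA k) (by
    rw [abs_of_nonneg (disjointify_nonneg x s k), abs_of_nonneg (hx0 k)]
    exact disjointify_le hx0 hs0 k)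
  have h1 := hk _ hyA
  rw [dist_zero_left, Real.norm_eq_abs, (hh k).2.2] at h1
  have h2 := dual_apply_mono (hg0 k) (le_disjointify x s k)
  rw [map_sub, map_sub, map_smul, map_smul, map_sum, smul_eq_mul, smul_eq_mul] at h2
  have h3 : (1 / 2 : ℝ) ^ k * g k s ≤ g k s :=
    mul_le_of_le_one_left (hg0 k s hs0) (pow_le_one₀ (by norm_num) (by norm_num))
  have h4 : (4 : ℝ) ^ k * ∑ i ∈ Finset.range k, g k (x i) ≤ ε / 4 := hφle k
  linarith [hgx k, le_abs_self (g k (disjointify x s k))]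

/-- The adjoint of an order bounded operator sends functionals with weak* null moduli to
functionals with weak* null moduli. -/
theorem IsOrderBounded.isWeakStarNull_abs_comp {F : Type*} [NormedAddCommGroup F] [NormedSpace ℝ F]
    [Lattice F] [IsOrderedAddMonoid F] [IsOrderedModule ℝ F] [HasSolidNorm F]
    {T : E →L[ℝ] F} (hT : IsOrderBounded (T : E →ₗ[ℝ] F)) {f : ℕ → StrongDual ℝ F}
    (hf : IsWeakStarNull fun n => |f n|) : IsWeakStarNull fun n => |(f n).comp T| := by
  refine isWeakStarNull_iff_of_nonneg.2 fun x hx => ?_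
  obtain ⟨⟨b, hb⟩, ⟨c, hc⟩⟩ := hT (Set.Icc (-x) x) bddBelow_Icc bddAbove_Icc
  refine squeeze_zero (fun n => ?_) (fun n => ?_) (isWeakStarNull_iff.1 hf (|b| ⊔ |c|))
  · exact (abs_nonneg ((f n).comp T) : 0 ≤ |(f n).comp T|) x hx
  · refine abs_dual_apply_le hx fun y hy => ?_
    have hmem : y ∈ Set.Icc (-x) x :=
      ⟨neg_le.1 ((neg_le_abs y).trans hy), (le_abs_self y).trans hy⟩
    have h1 : b ≤ T y := hb ⟨y, hmem, rfl⟩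
    have h2 : T y ≤ c := hc ⟨y, hmem, rfl⟩
    refine (le_abs_self (f n (T y))).trans ((abs_apply_le (f n) (T y)).trans ?_)
    refine dual_apply_mono (abs_nonneg (f n)) (abs_le'.2 ⟨?_, ?_⟩)
    · exact h2.trans ((le_abs_self c).trans le_sup_right)
    · exact (neg_le_neg h1).trans ((neg_le_abs b).trans le_sup_left)

end BanachLattice

end BanachLattice

theorem theorem2p3 {E F : Type*}
    [NormedAddCommGroup E] [NormedSpace ℝ E] [CompleteSpace E] [Lattice E] [IsOrderedAddMonoid E]
    [IsOrderedModule ℝ E] [HasSolidNorm E]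
    [NormedAddCommGroup F] [NormedSpace ℝ F] [CompleteSpace F] [Lattice F] [IsOrderedAddMonoid F]
    [IsOrderedModule ℝ F] [HasSolidNorm F]
    (T : E →ₗ[ℝ] F) (hT : BanachLattice.IsOrderBounded T)
    (A : Set E) (hA_solid : LatticeOrderedAddCommGroup.IsSolid A)
    (hA : BanachLattice.IsAlmostLimited A)
    (hF : BanachLattice.HasPropertyD F) :
    BanachLattice.IsAlmostLimited (T '' A) := by
  let S : E →L[ℝ] F := ⟨T, hT.continuous⟩
  refine ⟨hA.1.image S, fun f hdisj hnull => ?_⟩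
  have h := hA.tendstoUniformlyOn_of_abs hA_solid
    (BanachLattice.IsOrderBounded.isWeakStarNull_abs_comp (T := S) hT (hF f hdisj hnull))
  rw [Metric.tendstoUniformlyOn_iff] at h ⊢
  intro ε hε
  filter_upwards [h ε hε] with n hn
  rintro _ ⟨x, hx, rfl⟩
  exact hn x hx
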